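/- **3-butterflies.** A 3-butterfly is a 6-tuple of integers $(p,n,q,m,s,l)$ with $p\ge q\ge s\ge 2$, $p+1\le s+q$, $1\le n\le p$, $1\le m\le q$, $1\le l\le s$, $n+m\ne q+1$, $n+l\ne p+1$, and such that - if $m>q+s-p$, then $n+m\ne 2q+1$ and $n+m\neq 2q-p+1$; - if $l\le p-q$, then $n+l\ne p-s+1$; - if $m\le q+s-p$, then $m+l\ne s+1$. Put $t=p+q-s$, $v=q+s-p$, $w=p+s-q$, and let $A=\{a_i: i\in\mathbb Z/2p\}$, $B=\{b_j: j\in\mathbb Z/2q\}$, $C=\{c_k: k\in\mathbb Z/2s\}$ be disjoint sets of labels. Let $\gamma$ and $\phi$ be the involutions of $A\cup B\cup C$ given by $\gamma(a_i)=a_{-i}$, $\gamma(b_j)=b_{-j}$, $\gamma(c_k)=c_{-k}$ and $$a_{n-i}\leftrightarrow b_{m+i-1}\ (1\le i\le t),\qquad a_{n+j}\leftrightarrow c_{l-j-1}\ (0\le j\le w-1),\qquad b_{m-h}\leftrightarrow c_{l+h-1}\ (1\le h\le v).$$ Let $\mu=\phi\gamma$ (first $\gamma$, then $\phi$) and $E=\{a_0,a_p,b_0,b_q,c_0,c_s\}$.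 **The diagram.** The link diagram of the 3-butterfly is the following. Draw three segments $a,b,c$, divided in $p,q,s$ equal parts, respectively, and label the boundary of a thin neighbourhood of $a$ counterclockwise by $a_0,\dots,a_{2p-1}$, where $a_0,a_p$ are the endpoints of the segment $a$ and, for $0<i<p$, the labels $a_i$ and $a_{2p-i}$ lie on the two sides of the $i$-th division point; do the same for $b$ and $c$. At the $i$-th division point, an arc from $a_i$ to $a_{2p-i}$ crosses under the segment $a$, and likewise for $b$ and $c$. Outside these neighbourhoods, each label $x$ is joined to $\phi(x)$ by an arc, these arcs being pairwise disjoint. A *bridge* of a link diagram is a maximal overpass containing at least one overcrossing. A component of a diagram is *trivial* if it passes under at all of its crossings, or over at all of its crossings (so it is a simple closed curve lying entirely below, or entirely above, the rest of the diagram). The 3-butterfly is *reduced*, and $(p/n,q/m,s/l)$ is called a *Schubert form* of a 3-bridge link, if its diagram has exactly three bridges and no trivial component. **Theorem.** Let $(p,n,q,m,s,l)$ be a 3-butterfly. Then $(p/n,q/m,s/l)$ is a Schubert form of a 3-bridge link if and only if $\mu=\tau_1\tau_2\tau_3$ for three pairwise disjoint cycles $\tau_1,\tau_2,\tau_3$,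 each of which contains exactly two elements of $E$. -/

import Mathlib

/-! ## Link diagrams -/

/-- A link diagram, recorded up to isotopy by its crossings and the way they are connected.
At every crossing `x` four ends of strands meet, `(x, 0), (x, 1), (x, 2), (x, 3)` in
counterclockwise order; `(x, 0)` and `(x, 2)` are the two ends of the strand that passes under,
`(x, 1)` and `(x, 3)` are the two ends of the strand that passes over. The edges of the diagram
join these ends in pairs: `join` exchanges the two ends of each edge.
Circles without crossings are not recorded, and planarity is not part of the data: the diagrams
considered below are drawn in the plane and each of their components has a crossing. -/
structure LinkDiagram where
  /-- the crossings -/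
  Crossing : Type
  finite_crossing : Finite Crossing
  /-- the other end of the same edge -/
  join : Crossing × Fin 4 → Crossing × Fin 4
  join_join : ∀ d, join (join d) = d
  join_ne : ∀ d, join d ≠ d

namespace LinkDiagram

variable (D : LinkDiagram)

/-- The strand end `d` belongs to the overpassing strand of its crossing. -/
def IsOver (d : D.Crossing × Fin 4) : Prop := d.2 = 1 ∨ d.2 = 3

/-- The strand end `d` belongs to the underpassing strand of its crossing. -/
def IsUnder (d : D.Crossing × Fin 4) : Prop := d.2 = 0 ∨ d.2 = 2

/-- Two strand ends lie on the same component of the link if one gets from one to the other by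
running along edges and going straight through crossings. -/
def SameComponent : D.Crossing × Fin 4 → D.Crossing × Fin 4 → Prop :=
  Relation.EqvGen fun d d' => d' = D.join d ∨ d' = (d.1, d.2 + 2)

/-- A component is trivial if it passes under at all of its crossings, or passes over at all of
its crossings. (It then has no crossing with itself, so it is a simple closed curve lying entirely
below, or entirely above, the rest of the diagram.) -/
def HasTrivialComponent : Prop :=
  ∃ d, (∀ d', D.SameComponent d d' → D.IsUnder d') ∨ (∀ d', D.SameComponent d d' → D.IsOver d')

/-- Each crossing has exactly one overpassing strand. The overpassing strands at `x` and at `y` are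
on the same bridge if they are linked by a chain of edges joining overpasses to overpasses. -/
def bridgeSetoid : Setoid D.Crossing :=
  Relation.EqvGen.setoid fun x y => ∃ i j : Fin 4,
    D.IsOver (x, i) ∧ D.IsOver (y, j) ∧ D.join (x, i) = (y, j)

/-- The number of bridges, i.e. of maximal overpasses (with at least one overcrossing). -/
noncomputable def numBridges : ℕ := Nat.card (Quotient D.bridgeSetoid)

end LinkDiagram

/-! ## 3-butterflies -/

/-- A 3-butterfly `(p, n, q, m, s, l)`. -/
structure ThreeButterfly where
  (p n q m s l : ℕ)
  hpq : q ≤ p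
  hqs : s ≤ q
  hs : 2 ≤ s
  hn : 1 ≤ n ∧ n ≤ p
  hm : 1 ≤ m ∧ m ≤ q
  hl : 1 ≤ l ∧ l ≤ s
  hpsq : p + 1 ≤ s + q
  hnm : n + m ≠ q + 1
  hnl : n + l ≠ p + 1
  hnm' : (m : ℤ) > q + s - p →
    (n + m : ℤ) ≠ 2 * q + 1 ∧ (n + m : ℤ) ≠ 2 * q - p + 1
  hnl' : (l : ℤ) ≤ p - q → (n + l : ℤ) ≠ p - s + 1
  hml : (m : ℤ) ≤ q + s - p → m + l ≠ s + 1

/-- The names of the three bridges. -/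
inductive BridgeName
  | a | b | c

instance : Finite BridgeName :=
  Finite.of_injective (fun | .a => (0 : Fin 3) | .b => 1 | .c => 2) (by
    rintro (_ | _ | _) (_ | _ | _) h <;> simp_all)

namespace ThreeButterfly

variable (B : ThreeButterfly)

/-- Bridges `a`, `b`, `c` are divided in `p`, `q`, `s` segments. -/
def len : BridgeName → ℕ
  | .a => B.p
  | .b => B.q
  | .c => B.s

/-- The set `A ∪ B ∪ C` of the labels `a_i`, `i ∈ ℤ/2p`, `b_j`, `j ∈ ℤ/2q`, `c_k`, `k ∈ ℤ/2s`. -/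
abbrev Label : Type := (β : BridgeName) × ZMod (2 * B.len β)

/-- The label `a_i`. -/
abbrev la (i : ZMod (2 * B.p)) : B.Label := ⟨.a, i⟩
/-- The label `b_j`. -/
abbrev lb (j : ZMod (2 * B.q)) : B.Label := ⟨.b, j⟩
/-- The label `c_k`. -/
abbrev lc (k : ZMod (2 * B.s)) : B.Label := ⟨.c, k⟩

/-- The number of arcs between bridges `a` and `b`. -/
def t : ℕ := B.p + B.q - B.s
/-- The number of arcs between bridges `b` and `c`. -/
def v : ℕ := B.q + B.s - B.p
/-- The number of arcs between bridges `c` and `a`. -/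
def w : ℕ := B.p + B.s - B.q

theorem two_le_len (β : BridgeName) : 2 ≤ B.len β := by
  have := B.hpq; have := B.hqs; have := B.hs
  cases β <;> simp only [len] <;> omega

instance (β : BridgeName) : NeZero (2 * B.len β) :=
  ⟨by have := B.two_le_len β; omega⟩
instance : NeZero (2 * B.p) := inferInstanceAs (NeZero (2 * B.len .a))
instance : NeZero (2 * B.q) := inferInstanceAs (NeZero (2 * B.len .b))
instance : NeZero (2 * B.s) := inferInstanceAs (NeZero (2 * B.len .c))

/-- The reflection along the bridges, `a_i ↦ a_{2p-i}`, `b_j ↦ b_{2q-j}`, `c_k ↦ c_{2s-k}`. -/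
def gamma : Equiv.Perm B.Label :=
  Function.Involutive.toPerm (fun x => ⟨x.1, -x.2⟩) (fun x => by simp)

/-- `φ` on the labels `a_x`. -/
def phiA (x : ZMod (2 * B.p)) : B.Label :=
  let k := (B.n - 1 - x : ZMod (2 * B.p)).val
  if k < B.t then B.lb (B.m + k) else B.lc (B.l - (2 * B.p - 1 - k : ℕ) - 1)

/-- `φ` on the labels `b_y`. -/
def phiB (y : ZMod (2 * B.q)) : B.Label :=
  let k := (y - B.m : ZMod (2 * B.q)).val
  if k < B.t then B.la (B.n - 1 - k) else B.lc (B.l + (2 * B.q - k : ℕ) - 1)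

/-- `φ` on the labels `c_z`. -/
def phiC (z : ZMod (2 * B.s)) : B.Label :=
  let k := (z - B.l : ZMod (2 * B.s)).val
  if k < B.v then B.lb (B.m - 1 - k) else B.la (B.n + (2 * B.s - 1 - k : ℕ))

/-- The map exchanging `a_{n-i}` with `b_{m+i-1}` for `1 ≤ i ≤ t`, `a_{n+j}` with `c_{l-j-1}` for
`0 ≤ j ≤ w-1`, and `b_{m-h}` with `c_{l+h-1}` for `1 ≤ h ≤ v`. It is characterized by the theorems
`phiFun_ab`, `phiFun_ac`, `phiFun_bc` below. -/
def phiFun : B.Label → B.Label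
  | ⟨.a, x⟩ => B.phiA x
  | ⟨.b, y⟩ => B.phiB y
  | ⟨.c, z⟩ => B.phiC z

theorem tvw : B.t + B.w = 2 * B.p ∧ B.t + B.v = 2 * B.q ∧ B.v + B.w = 2 * B.s := by
  have := B.hpq; have := B.hqs; have := B.hs; have := B.hpsq
  simp only [t, v, w]; omega

theorem val_neg_natCast {N k : ℕ} [NeZero N] (h1 : 1 ≤ k) (h2 : k ≤ N) :
    (-(k : ZMod N)).val = N - k := by
  have h : (-(k : ZMod N)) = ((N - k : ℕ) : ZMod N) := by
    rw [Nat.cast_sub h2]; simp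
  rw [h, ZMod.val_natCast_of_lt (by omega)]

theorem phiFun_ab (i : ℕ) (h1 : 1 ≤ i) (h2 : i ≤ B.t) :
    B.phiFun (B.la (B.n - i)) = B.lb (B.m + i - 1) ∧
    B.phiFun (B.lb (B.m + i - 1)) = B.la (B.n - i) := by
  obtain ⟨k, rfl⟩ : ∃ k, i = k + 1 := ⟨i - 1, by omega⟩
  have := B.tvw
  have hv := B.hpsq
  have e1 : ZMod.val (n := 2 * B.p) (B.n - 1 - (B.n - (k + 1 : ℕ))) = k := by
    rw [show ((B.n : ZMod (2 * B.p)) - 1 - (B.n - (k + 1 : ℕ))) = (k : ℕ) by push_cast; ring]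
    exact ZMod.val_natCast_of_lt (by omega)
  have e2 : ZMod.val (n := 2 * B.q) (B.m + (k + 1 : ℕ) - 1 - B.m) = k := by
    rw [show ((B.m : ZMod (2 * B.q)) + (k + 1 : ℕ) - 1 - B.m) = (k : ℕ) by push_cast; ring]
    exact ZMod.val_natCast_of_lt (by omega)
  constructor
  · simp only [phiFun, phiA, e1, if_pos (show k < B.t by omega)]
    congr 1; push_cast; ring
  · simp only [phiFun, phiB, e2, if_pos (show k < B.t by omega)]
    congr 1; push_cast; ring

theorem phiFun_ac (j : ℕ) (hj : j < B.w) :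
    B.phiFun (B.la (B.n + j)) = B.lc (B.l - j - 1) ∧
    B.phiFun (B.lc (B.l - j - 1)) = B.la (B.n + j) := by
  have := B.tvw
  have e1 : ZMod.val (n := 2 * B.p) (B.n - 1 - (B.n + j)) = 2 * B.p - (j + 1) := by
    rw [show ((B.n : ZMod (2 * B.p)) - 1 - (B.n + j)) = -((j + 1 : ℕ)) by push_cast; ring]
    exact val_neg_natCast (by omega) (by omega)
  have e2 : ZMod.val (n := 2 * B.s) (B.l - j - 1 - B.l) = 2 * B.s - (j + 1) := by
    rw [show ((B.l : ZMod (2 * B.s)) - j - 1 - B.l) = -((j + 1 : ℕ)) by push_cast; ring]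
    exact val_neg_natCast (by omega) (by omega)
  constructor
  · simp only [phiFun, phiA, e1, if_neg (show ¬ (2 * B.p - (j + 1) < B.t) by omega)]
    rw [show 2 * B.p - 1 - (2 * B.p - (j + 1)) = j by omega]
  · simp only [phiFun, phiC, e2, if_neg (show ¬ (2 * B.s - (j + 1) < B.v) by omega)]
    rw [show 2 * B.s - 1 - (2 * B.s - (j + 1)) = j by omega]

theorem phiFun_bc (h : ℕ) (h1 : 1 ≤ h) (h2 : h ≤ B.v) :
    B.phiFun (B.lb (B.m - h)) = B.lc (B.l + h - 1) ∧
    B.phiFun (B.lc (B.l + h - 1)) = B.lb (B.m - h) := by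
  obtain ⟨k, rfl⟩ : ∃ k, h = k + 1 := ⟨h - 1, by omega⟩
  have := B.tvw
  have e1 : ZMod.val (n := 2 * B.q) (B.m - (k + 1 : ℕ) - B.m) = 2 * B.q - (k + 1) := by
    rw [show ((B.m : ZMod (2 * B.q)) - (k + 1 : ℕ) - B.m) = -((k + 1 : ℕ)) by push_cast; ring]
    exact val_neg_natCast (by omega) (by omega)
  have e2 : ZMod.val (n := 2 * B.s) (B.l + (k + 1 : ℕ) - 1 - B.l) = k := by
    rw [show ((B.l : ZMod (2 * B.s)) + (k + 1 : ℕ) - 1 - B.l) = (k : ℕ) by push_cast; ring]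
    exact ZMod.val_natCast_of_lt (by have := B.hs; have := B.hqs; have := B.hpq; omega)
  constructor
  · simp only [phiFun, phiB, e1, if_neg (show ¬ (2 * B.q - (k + 1) < B.t) by omega)]
    rw [show 2 * B.q - (2 * B.q - (k + 1)) = k + 1 by omega]
  · simp only [phiFun, phiC, e2, if_pos (show k < B.v by omega)]
    congr 1; push_cast; ring

/-- Every label occurs in exactly one of the three families. -/
theorem label_cases (x : B.Label) :
    (∃ i : ℕ, 1 ≤ i ∧ i ≤ B.t ∧ (x = B.la (B.n - i) ∨ x = B.lb (B.m + i - 1))) ∨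
    (∃ j : ℕ, j < B.w ∧ (x = B.la (B.n + j) ∨ x = B.lc (B.l - j - 1))) ∨
    (∃ h : ℕ, 1 ≤ h ∧ h ≤ B.v ∧ (x = B.lb (B.m - h) ∨ x = B.lc (B.l + h - 1))) := by
  have := B.tvw
  rcases x with ⟨_ | _ | _, x⟩
  · change ZMod (2 * B.p) at x
    have hk := ZMod.val_lt (B.n - 1 - x : ZMod (2 * B.p))
    have hx := ZMod.natCast_zmod_val (B.n - 1 - x : ZMod (2 * B.p))
    set k := ZMod.val (B.n - 1 - x : ZMod (2 * B.p))
    by_cases h : k < B.t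
    · refine Or.inl ⟨k + 1, by omega, by omega, Or.inl ?_⟩
      refine congrArg B.la ?_; push_cast; rw [hx]; ring
    · refine Or.inr (Or.inl ⟨2 * B.p - (k + 1), by omega, Or.inl ?_⟩)
      refine congrArg B.la ?_; rw [Nat.cast_sub (by omega), ZMod.natCast_self]; push_cast; rw [hx]; ring
  · change ZMod (2 * B.q) at x
    have hk := ZMod.val_lt (x - B.m : ZMod (2 * B.q))
    have hx := ZMod.natCast_zmod_val (x - B.m : ZMod (2 * B.q))
    set k := ZMod.val (x - B.m : ZMod (2 * B.q))
    by_cases h : k < B.t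
    · refine Or.inl ⟨k + 1, by omega, by omega, Or.inr ?_⟩
      refine congrArg B.lb ?_; push_cast; rw [hx]; ring
    · refine Or.inr (Or.inr ⟨2 * B.q - k, by omega, by omega, Or.inl ?_⟩)
      refine congrArg B.lb ?_; rw [Nat.cast_sub (by omega), ZMod.natCast_self, hx]; ring
  · change ZMod (2 * B.s) at x
    have hk := ZMod.val_lt (x - B.l : ZMod (2 * B.s))
    have hx := ZMod.natCast_zmod_val (x - B.l : ZMod (2 * B.s))
    set k := ZMod.val (x - B.l : ZMod (2 * B.s))
    by_cases h : k < B.v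
    · refine Or.inr (Or.inr ⟨k + 1, by omega, by omega, Or.inr ?_⟩)
      refine congrArg B.lc ?_; push_cast; rw [hx]; ring
    · refine Or.inr (Or.inl ⟨2 * B.s - (k + 1), by omega, Or.inr ?_⟩)
      refine congrArg B.lc ?_; rw [Nat.cast_sub (by omega), ZMod.natCast_self]; push_cast; rw [hx]; ring

theorem phiFun_phiFun (x : B.Label) : B.phiFun (B.phiFun x) = x := by
  rcases B.label_cases x with ⟨i, h1, h2, rfl | rfl⟩ | ⟨j, h1, rfl | rfl⟩ | ⟨h, h1, h2, rfl | rfl⟩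
  · rw [(B.phiFun_ab i h1 h2).1, (B.phiFun_ab i h1 h2).2]
  · rw [(B.phiFun_ab i h1 h2).2, (B.phiFun_ab i h1 h2).1]
  · rw [(B.phiFun_ac j h1).1, (B.phiFun_ac j h1).2]
  · rw [(B.phiFun_ac j h1).2, (B.phiFun_ac j h1).1]
  · rw [(B.phiFun_bc h h1 h2).1, (B.phiFun_bc h h1 h2).2]
  · rw [(B.phiFun_bc h h1 h2).2, (B.phiFun_bc h h1 h2).1]

/-- The permutation `φ` given by the arcs that connect the three butterflies. -/
def phi : Equiv.Perm B.Label := Function.Involutive.toPerm B.phiFun B.phiFun_phiFun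

theorem phi_ab (i : ℕ) (h1 : 1 ≤ i) (h2 : i ≤ B.t) :
    B.phi (B.la (B.n - i)) = B.lb (B.m + i - 1) := (B.phiFun_ab i h1 h2).1

theorem phi_ac (j : ℕ) (hj : j < B.w) :
    B.phi (B.la (B.n + j)) = B.lc (B.l - j - 1) := (B.phiFun_ac j hj).1

theorem phi_bc (h : ℕ) (h1 : 1 ≤ h) (h2 : h ≤ B.v) :
    B.phi (B.lb (B.m - h)) = B.lc (B.l + h - 1) := (B.phiFun_bc h h1 h2).1

theorem phi_phi (x : B.Label) : B.phi (B.phi x) = x := B.phiFun_phiFun x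

theorem phi_fst_ne (x : B.Label) : (B.phi x).1 ≠ x.1 := by
  change (B.phiFun x).1 ≠ x.1
  rcases x with ⟨_ | _ | _, x⟩ <;> simp only [phiFun, phiA, phiB, phiC] <;> split_ifs <;> simp

/-- The permutation `μ = φγ` (first `γ`, then `φ`). -/
def mu : Equiv.Perm B.Label := B.phi * B.gamma

/-- The set `E` of the endpoints of the bridges. -/
def E : Set B.Label :=
  {B.la 0, B.la (B.p : ZMod (2 * B.p)), B.lb 0, B.lb (B.q : ZMod (2 * B.q)),
    B.lc 0, B.lc (B.s : ZMod (2 * B.s))}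

/-! ## The canonical diagram of a 3-butterfly

Each bridge `β` is a straight segment with endpoints `β_0` and `β_len`, cut in `len β` parts. At
the `i`-th interior division point, `0 < i < len β`, an underarc crosses below the bridge from `β_i`
to `β_{-i}`. The labels run counterclockwise around the bridge, so at this crossing one meets, in
counterclockwise order, the underarc end at `β_i`, the part of the bridge towards `β_len`, the
underarc end at `β_{-i}`, and the part of the bridge towards `β_0`. Outside the bridges, the label
`x` is connected by an arc with the label `φ x`. -/

/-- The crossings of the canonical diagram: interior division points of the bridges. -/
abbrev Crossing : Type := (β : BridgeName) × Set.Ioo 0 (B.len β)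

/-- The strand end reached when one arrives from outside at the label `x`: at a bridge endpoint,
this is the bridge at its first crossing, and otherwise it is the underarc at its crossing with the
bridge. -/
def attach (x : B.Label) : B.Crossing × Fin 4 :=
  have h2 := B.two_le_len x.1
  have hv := ZMod.val_lt x.2
  if h0 : x.2.val = 0 then (⟨x.1, 1, by constructor <;> omega⟩, 3)
  else if h1 : x.2.val < B.len x.1 then (⟨x.1, x.2.val, by constructor <;> omega⟩, 0)
  else if h2 : x.2.val = B.len x.1 then (⟨x.1, B.len x.1 - 1, by constructor <;> omega⟩, 1)
  else (⟨x.1, 2 * B.len x.1 - x.2.val, by constructor <;> omega⟩, 2)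

/-- Running outwards from a strand end of a crossing, one either stays on the same bridge and
arrives at the neighbouring crossing, or leaves through a label `x` along the arc to `φ x`. -/
def joinFun : B.Crossing × Fin 4 → B.Crossing × Fin 4
  | (⟨β, i⟩, 0) => B.attach (B.phi ⟨β, (i : ℕ)⟩)
  | (⟨β, i⟩, 1) =>
      if h : i + 1 < B.len β then (⟨β, i + 1, Nat.succ_pos _, h⟩, 3)
      else B.attach (B.phi ⟨β, (B.len β : ℕ)⟩)
  | (⟨β, i⟩, 2) => B.attach (B.phi ⟨β, -(i : ℕ)⟩)
  | (⟨β, i⟩, 3) =>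
      if h : 1 < (i : ℕ) then (⟨β, i - 1, by omega, by have := i.2.2; omega⟩, 1)
      else B.attach (B.phi ⟨β, 0⟩)

theorem joinFun_attach (x : B.Label) : B.joinFun (B.attach x) = B.attach (B.phi x) := by
  obtain ⟨β, x⟩ := x
  have h2 := B.two_le_len β
  have hv := ZMod.val_lt x
  have hx := ZMod.natCast_zmod_val x
  generalize hy : B.attach (B.phi ⟨β, x⟩) = y
  unfold attach
  simp only
  split_ifs with a1 a2 a3
  · simp only [joinFun]
    rw [dif_neg (by simp), ← hy, (ZMod.val_eq_zero x).1 a1]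
  · simp only [joinFun]
    rw [hx, hy]
  · simp only [joinFun]
    rw [dif_neg (by omega), ← hy, show ((B.len β : ℕ) : ZMod (2 * B.len β)) = x from by
      rw [← hx]; exact congrArg _ a3.symm]
  · simp only [joinFun]
    rw [Nat.cast_sub (by omega), ZMod.natCast_self, hx, zero_sub, neg_neg, hy]

/-- Every strand end is attached to a label or lies in the middle of a bridge. -/
theorem dart_cases (d : B.Crossing × Fin 4) :
    (∃ x, d = B.attach x) ∨
    ∃ (β : BridgeName) (i : ℕ) (h : 0 < i) (h' : i + 1 < B.len β),
      d = (⟨β, i, h, by omega⟩, 1) ∨ d = (⟨β, i + 1, by omega, h'⟩, 3) := by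
  obtain ⟨⟨β, i, hi, hi'⟩, k⟩ := d
  have h2 := B.two_le_len β
  fin_cases k
  · refine Or.inl ⟨⟨β, (i : ℕ)⟩, ?_⟩
    have : ((i : ℕ) : ZMod (2 * B.len β)).val = i := ZMod.val_natCast_of_lt (by omega)
    simp only [attach, this]
    rw [dif_neg (by omega), dif_pos hi']; rfl
  · by_cases h : i + 1 < B.len β
    · exact Or.inr ⟨β, i, hi, h, Or.inl rfl⟩
    · refine Or.inl ⟨⟨β, (B.len β : ℕ)⟩, ?_⟩
      have : ((B.len β : ℕ) : ZMod (2 * B.len β)).val = B.len β :=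
        ZMod.val_natCast_of_lt (by omega)
      simp only [attach, this]
      rw [dif_neg (by omega), dif_neg (by omega), dif_pos trivial]
      obtain rfl : i = B.len β - 1 := by omega
      rfl
  · refine Or.inl ⟨⟨β, -(i : ℕ)⟩, ?_⟩
    have : (-((i : ℕ) : ZMod (2 * B.len β))).val = 2 * B.len β - i :=
      val_neg_natCast (by omega) (by omega)
    simp only [attach, this]
    rw [dif_neg (by omega), dif_neg (by omega), dif_neg (by omega)]
    have e : 2 * B.len β - (2 * B.len β - i) = i := by omega
    simp only [e]; rfl
  · by_cases h : 1 < i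
    · obtain ⟨j, rfl⟩ : ∃ j, i = j + 1 := ⟨i - 1, by omega⟩
      exact Or.inr ⟨β, j, by omega, hi', Or.inr rfl⟩
    · refine Or.inl ⟨⟨β, 0⟩, ?_⟩
      simp only [attach, ZMod.val_zero]
      rw [dif_pos trivial]
      obtain rfl : i = 1 := by omega
      rfl

theorem attach_fst (x : B.Label) : (B.attach x).1.1 = x.1 := by
  unfold attach
  simp only
  split_ifs <;> rfl

/-- The canonical diagram of the 3-butterfly. -/
def diagram : LinkDiagram where
  Crossing := B.Crossing
  finite_crossing := inferInstance
  join := B.joinFun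
  join_join d := by
    rcases B.dart_cases d with ⟨x, rfl⟩ | ⟨β, i, h, h', rfl | rfl⟩
    · rw [joinFun_attach, joinFun_attach, phi_phi]
    · simp only [joinFun]; rw [dif_pos h']; simp [h]
    · simp only [joinFun]; rw [dif_pos (by omega)]; simp [h']
  join_ne d := by
    rcases B.dart_cases d with ⟨x, rfl⟩ | ⟨β, i, h, h', rfl | rfl⟩
    · rw [joinFun_attach]
      intro e
      have := congrArg (fun d => d.1.1) e
      simp only [attach_fst] at this
      exact B.phi_fst_ne x this
    · simp only [joinFun]; rw [dif_pos h']; simp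
    · simp only [joinFun]; rw [dif_pos (by omega)]; simp

/-- A 3-butterfly is reduced if its diagram is a 3-bridge diagram without trivial components. -/
def IsReduced : Prop := B.diagram.numBridges = 3 ∧ ¬ B.diagram.HasTrivialComponent

/-- `(p/n, q/m, s/l)` is a Schubert form of a 3-bridge link. -/
def IsSchubertForm : Prop := B.IsReduced

end ThreeButterfly

/-! The butterfly inequalities say exactly what is needed for no arc to join two bridge endpoints
(`phi_notMem_E`). Hence an arc leaving the end of a segment arrives at an underpass: the bridges are
precisely the three segments (`numBridges_diagram`), and no component consists of overpasses only
(`not_forall_isOver`). What remains is to detect components lying entirely below.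

Away from `E`, `gamma` passes straight through a crossing along the underarc, and `phi` follows an
arc outside the bridges, so iterating `mu` traces the underpassing strand until it meets `E`. A
component is therefore all under exactly when its labels lie on cycles of `mu` that avoid `E`
(`not_hasTrivialComponent_iff`).

Finally, `gamma` and `phi` are involutions generating a dihedral action, and `E` is the fixed-point
set of `gamma`. On a cycle of `mu` through `E`, `gamma` is a reflection; since `phi` is fixed-point
free, the length is even and the reflection has exactly two fixed points
(`ncard_sameCycle_inter_E`). As `E` has six elements, all cycles meet `E` iff there are three cycles
with two endpoints each. -/

/-! ### Permutations with three cycles. -/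

/-- A product of three disjoint cycles, as an equality of sets of cycle factors. -/
theorem Equiv.Perm.cycleFactorsFinset_eq_triple_iff {α : Type*} [Fintype α] [DecidableEq α]
    {f : Equiv.Perm α} {τ : Fin 3 → Equiv.Perm α} (hτ : [τ 0, τ 1, τ 2].Nodup) :
    f.cycleFactorsFinset = {τ 0, τ 1, τ 2} ↔
      (∀ i, (τ i).IsCycle) ∧ (∀ i j, i ≠ j → (τ i).Disjoint (τ j)) ∧ f = τ 0 * τ 1 * τ 2 := by
  have h := Equiv.Perm.cycleFactorsFinset_eq_list_toFinset (σ := f) hτ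
  rw [show [τ 0, τ 1, τ 2].toFinset = {τ 0, τ 1, τ 2} by simp] at h
  rw [h]
  refine and_congr (by simp [Fin.forall_fin_succ]) (and_congr ?_ ?_)
  · constructor
    · simp only [List.pairwise_cons, List.mem_cons, List.not_mem_nil, or_false, forall_eq_or_imp,
        forall_eq]
      rintro ⟨⟨h1, h2⟩, h3, -⟩ i j hij
      fin_cases i <;> fin_cases j
      all_goals first | exact absurd rfl hij | skip
      exacts [h1, h2, h1.symm, h3, h2.symm, h3.symm]
    · intro h
      simp [h 0 1 (by decide), h 0 2 (by decide), h 1 2 (by decide)]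
  · rw [eq_comm]
    simp [mul_assoc]

/-- If every cycle of `f` through `E` has exactly two elements of `E`, where `E` has six elements,
then all cycles of `f` meet `E` iff `f` is a product of three disjoint cycles with two elements of
`E` each. -/
theorem Equiv.Perm.forall_sameCycle_iff_three_cycles {α : Type*} [Finite α] (f : Equiv.Perm α)
    (E : Set α) (hE : E.ncard = 6) (hf : ∀ x, f x ≠ x)
    (h2 : ∀ e ∈ E, ({x | f.SameCycle e x} ∩ E).ncard = 2) :
    (∀ x, ∃ e ∈ E, f.SameCycle e x) ↔
      ∃ τ : Fin 3 → Equiv.Perm α,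
        (∀ i, (τ i).IsCycle) ∧ (∀ i j, i ≠ j → (τ i).Disjoint (τ j)) ∧ f = τ 0 * τ 1 * τ 2 ∧
        ∀ i, ({x | τ i x ≠ x} ∩ E).ncard = 2 := by
  classical
  have := Fintype.ofFinite α
  have hsupp : ∀ x, x ∈ f.support := fun x => Equiv.Perm.mem_support.2 (hf x)
  have hmem : ∀ x y, f.cycleOf x y ≠ y ↔ f.SameCycle x y := fun x y => by
    rw [← Equiv.Perm.mem_support, Equiv.Perm.mem_support_cycleOf_iff]
    exact and_iff_left (hsupp x)
  constructor
  · intro H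
    have hcyc : ∀ c ∈ f.cycleFactorsFinset, ∃ e ∈ E, c = f.cycleOf e := by
      intro c hc
      obtain ⟨x, hx⟩ := (Equiv.Perm.mem_cycleFactorsFinset_iff.1 hc).1.nonempty_support
      obtain ⟨e, he, hex⟩ := H x
      exact ⟨e, he, (Equiv.Perm.cycle_is_cycleOf hx hc).trans hex.cycleOf_eq.symm⟩
    have hcard : f.cycleFactorsFinset.card = 3 := by
      -- Counting `E` by the cycle containing each element gives 6 = 2 · (number of cycles).
      have h := Finset.card_eq_sum_card_fiberwise (s := E.toFinset) (t := f.cycleFactorsFinset)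
        (f := f.cycleOf) fun x _ => Equiv.Perm.cycleOf_mem_cycleFactorsFinset_iff.2 (hsupp x)
      rw [← Set.ncard_eq_toFinset_card', hE, Finset.sum_const_nat (m := 2)] at h
      · omega
      · intro c hc
        obtain ⟨e, he, rfl⟩ := hcyc c hc
        rw [← h2 e he, ← Set.ncard_coe_finset]
        congr 1
        ext x
        have : f.cycleOf x = f.cycleOf e ↔ f.SameCycle e x := by
          constructor
          · intro h
            rw [← hmem, ← h, hmem]
          · exact fun h => h.cycleOf_eq.symm
        simp [this, and_comm]
    obtain ⟨a, b, c, hab, hac, hbc, habc⟩ := Finset.card_eq_three.1 hcard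
    refine ⟨![a, b, c], ?_⟩
    obtain ⟨h3, h4, h5⟩ := (Equiv.Perm.cycleFactorsFinset_eq_triple_iff (f := f) (τ := ![a, b, c])
      (by simp [hab, hac, hbc])).1 (by simpa using habc)
    refine ⟨h3, h4, h5, fun i => ?_⟩
    obtain ⟨e, he, hi⟩ := hcyc (![a, b, c] i) (by rw [habc]; fin_cases i <;> simp)
    rw [hi]
    simpa only [hmem] using h2 e he
  · rintro ⟨τ, h3, h4, h5, h6⟩ x
    -- Two equal disjoint permutations are trivial, which a cycle is not.
    have hne : ∀ i j, i ≠ j → τ i ≠ τ j := fun i j hij h =>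
      (h3 j).ne_one (Equiv.Perm.disjoint_refl_iff.1 (h ▸ h4 i j hij))
    have hS := (Equiv.Perm.cycleFactorsFinset_eq_triple_iff (f := f) (τ := τ)
      (by simp [hne 0 1, hne 0 2, hne 1 2])).2 ⟨h3, h4, h5⟩
    have hx := Equiv.Perm.cycleOf_mem_cycleFactorsFinset_iff.2 (hsupp x)
    obtain ⟨i, hi⟩ : ∃ i, f.cycleOf x = τ i := by
      simp only [hS, Finset.mem_insert, Finset.mem_singleton] at hx
      rcases hx with h | h | h
      exacts [⟨_, h⟩, ⟨_, h⟩, ⟨_, h⟩]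
    obtain ⟨e, he, heE⟩ := Set.nonempty_of_ncard_ne_zero (by rw [h6 i]; decide)
    exact ⟨e, heE, ((hmem x e).1 (by rw [hi]; exact he)).symm⟩

/-! ### Endpoints of bridges as fixed points of the reflection. -/

namespace ThreeButterfly

variable (B : ThreeButterfly)

theorem card_bridgeName : Nat.card BridgeName = 3 := by
  have e3 : Function.Bijective (![.a, .b, .c] : Fin 3 → BridgeName) := by
    constructor
    · intro i j
      fin_cases i <;> fin_cases j <;> simp
    · rintro (_ | _ | _)
      exacts [⟨0, rfl⟩, ⟨1, rfl⟩, ⟨2, rfl⟩]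
  rw [← Nat.card_congr (Equiv.ofBijective _ e3), Nat.card_fin]

/-- The endpoints of the bridges, indexed by the bridge and the end. -/
def endpoint (i : BridgeName × Bool) : B.Label := ⟨i.1, if i.2 then (B.len i.1 : ℕ) else 0⟩

theorem range_endpoint : Set.range B.endpoint = B.E := by
  ext x
  constructor
  · rintro ⟨⟨_ | _ | _, _ | _⟩, rfl⟩
    exacts [.inl rfl, .inr (.inl rfl), .inr (.inr (.inl rfl)), .inr (.inr (.inr (.inl rfl))),
      .inr (.inr (.inr (.inr (.inl rfl)))), .inr (.inr (.inr (.inr (.inr rfl))))]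
  · rintro (rfl | rfl | rfl | rfl | rfl | rfl)
    exacts [⟨(.a, false), rfl⟩, ⟨(.a, true), rfl⟩, ⟨(.b, false), rfl⟩, ⟨(.b, true), rfl⟩,
      ⟨(.c, false), rfl⟩, ⟨(.c, true), rfl⟩]

theorem val_len (β : BridgeName) : ((B.len β : ℕ) : ZMod (2 * B.len β)).val = B.len β :=
  ZMod.val_natCast_of_lt (by have := B.two_le_len β; omega)

theorem mem_E_iff_val (x : B.Label) : x ∈ B.E ↔ x.2.val = 0 ∨ x.2.val = B.len x.1 := by
  rw [← range_endpoint]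
  constructor
  · rintro ⟨⟨β, _ | _⟩, rfl⟩
    · exact .inl ZMod.val_zero
    · exact .inr (B.val_len β)
  · obtain ⟨β, x⟩ := x
    rintro (h | h)
    · refine ⟨(β, false), ?_⟩
      rw [(ZMod.val_eq_zero x).1 h]
      rfl
    · refine ⟨(β, true), ?_⟩
      rw [← ZMod.natCast_zmod_val x, h]
      rfl

theorem ncard_E : B.E.ncard = 6 := by
  have hinj : Function.Injective B.endpoint := by
    rintro ⟨β, b⟩ ⟨β', b'⟩ h
    obtain rfl : β = β' := congrArg Sigma.fst h
    have h2 := B.two_le_len β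
    have hv := congrArg (fun x : B.Label => x.2.val) h
    rcases b with _ | _ <;> rcases b' with _ | _
    · rfl
    · have : 0 = B.len β := ZMod.val_zero.symm.trans (hv.trans (B.val_len β))
      omega
    · have : 0 = B.len β := ZMod.val_zero.symm.trans (hv.symm.trans (B.val_len β))
      omega
    · rfl
  rw [← range_endpoint, ← Nat.card_coe_set_eq, Nat.card_range_of_injective hinj, Nat.card_prod,
    card_bridgeName, Nat.card_eq_fintype_card, Fintype.card_bool]

theorem gamma_mk (β : BridgeName) (x : ZMod (2 * B.len β)) : B.gamma ⟨β, x⟩ = ⟨β, -x⟩ := rfl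

theorem gamma_gamma (x : B.Label) : B.gamma (B.gamma x) = x := by
  obtain ⟨β, x⟩ := x
  simp [gamma_mk]

theorem gamma_eq_self_iff (x : B.Label) : B.gamma x = x ↔ x ∈ B.E := by
  rw [mem_E_iff_val]
  obtain ⟨β, x⟩ := x
  rw [gamma_mk, Sigma.mk.injEq, heq_eq_eq, eq_self_iff_true, true_and, ZMod.neg_eq_self_iff,
    ← ZMod.val_eq_zero]
  exact or_congr Iff.rfl ⟨fun h => by simpa using h, fun h => congrArg (2 * ·) h⟩

/-- Being fixed by `gamma` means 2z ≡ 0 modulo twice the length. With an integer representative `z`,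
membership in `E` can be compared with the butterfly inequalities. -/
theorem len_dvd_of_mem_E {β : BridgeName} {z : ℤ}
    (h : (⟨β, (z : ZMod (2 * B.len β))⟩ : B.Label) ∈ B.E) : ∃ c : ℤ, z = B.len β * c := by
  rw [← gamma_eq_self_iff, gamma_mk, Sigma.mk.injEq, heq_eq_eq] at h
  have h2 : ((2 * z : ℤ) : ZMod (2 * B.len β)) = 0 := by
    push_cast
    linear_combination -h.2
  obtain ⟨c, hc⟩ := (ZMod.intCast_zmod_eq_zero_iff_dvd _ _).1 h2
  refine ⟨c, ?_⟩
  push_cast at hc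
  linarith

theorem mem_E_la {y : ZMod (2 * B.p)} {z : ℤ} (hy : y = z) (h : B.la y ∈ B.E) :
    ∃ c : ℤ, z = B.p * c := by
  subst hy; exact B.len_dvd_of_mem_E h

theorem mem_E_lb {y : ZMod (2 * B.q)} {z : ℤ} (hy : y = z) (h : B.lb y ∈ B.E) :
    ∃ c : ℤ, z = B.q * c := by
  subst hy; exact B.len_dvd_of_mem_E h

theorem mem_E_lc {y : ZMod (2 * B.s)} {z : ℤ} (hy : y = z) (h : B.lc y ∈ B.E) :
    ∃ c : ℤ, z = B.s * c := by
  subst hy; exact B.len_dvd_of_mem_E h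

/-! ### Arcs never join two endpoints. -/

/-- Bounding the multiplier leaves finitely many values to substitute, after which the problem is
linear. -/
theorem eq_of_mul_bounds {a c k l : ℤ} (ha : 0 < a) (h1 : a * (k - 1) < a * c)
    (h2 : a * c < a * (l + 1)) : k ≤ c ∧ c ≤ l := by
  have := lt_of_mul_lt_mul_left h1 ha.le
  have := lt_of_mul_lt_mul_left h2 ha.le
  omega

/-- No arc of the diagram joins two endpoints of bridges. -/
theorem phi_notMem_E {x : B.Label} (hx : x ∈ B.E) : B.phi x ∉ B.E := by
  intro hy
  have hpq := B.hpq
  have hqs := B.hqs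
  have hs := B.hs
  have hn := B.hn
  have hm := B.hm
  have hl := B.hl
  have hpsq := B.hpsq
  have hnm := B.hnm
  have hnl := B.hnl
  have hnm' := B.hnm'
  have hnl' := B.hnl'
  have hml := B.hml
  rcases B.label_cases x with ⟨i, h1, h2, hxi⟩ | ⟨j, h1, hxj⟩ | ⟨h, h1, h2, hxh⟩
  · have ha : B.la (B.n - i) ∈ B.E ∧ B.lb (B.m + i - 1) ∈ B.E := by
      rcases hxi with rfl | rfl
      · exact ⟨hx, by rwa [B.phi_ab i h1 h2] at hy⟩
      · exact ⟨by rwa [← B.phi_ab i h1 h2, phi_phi] at hy, hx⟩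
    obtain ⟨c, hc⟩ := B.mem_E_la (z := B.n - i) (by push_cast; rfl) ha.1
    obtain ⟨d, hd⟩ := B.mem_E_lb (z := B.m + i - 1) (by push_cast; rfl) ha.2
    simp only [t] at h2
    obtain ⟨c1, c2⟩ := eq_of_mul_bounds (a := B.p) (c := c) (k := -1) (l := 0) (by omega)
      (by omega) (by omega)
    obtain ⟨d1, d2⟩ := eq_of_mul_bounds (a := B.q) (c := d) (k := 1) (l := 2) (by omega)
      (by omega) (by omega)
    -- The case (-1, 1) is impossible by size. The cases (0, 1), (0, 2) and (-1, 2) are excluded by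
    -- `hnm` and the two parts of `hnm'`, whose condition on `m` follows from `i ≤ t`.
    obtain rfl | rfl : c = -1 ∨ c = 0 := by omega
    all_goals obtain rfl | rfl : d = 1 ∨ d = 2 := by omega
    all_goals omega
  · have ha : B.la (B.n + j) ∈ B.E ∧ B.lc (B.l - j - 1) ∈ B.E := by
      rcases hxj with rfl | rfl
      · exact ⟨hx, by rwa [B.phi_ac j h1] at hy⟩
      · exact ⟨by rwa [← B.phi_ac j h1, phi_phi] at hy, hx⟩
    obtain ⟨c, hc⟩ := B.mem_E_la (z := B.n + j) (by push_cast; rfl) ha.1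
    obtain ⟨d, hd⟩ := B.mem_E_lc (z := B.l - j - 1) (by push_cast; rfl) ha.2
    simp only [w] at h1
    obtain ⟨c1, c2⟩ := eq_of_mul_bounds (a := B.p) (c := c) (k := 1) (l := 1) (by omega)
      (by omega) (by omega)
    obtain ⟨d1, d2⟩ := eq_of_mul_bounds (a := B.s) (c := d) (k := -1) (l := 0) (by omega)
      (by omega) (by omega)
    obtain rfl : c = 1 := by omega
    -- Here `d = 0` contradicts `hnl`; `d = -1` contradicts `hnl'`, since `j < w` forces `l ≤ p -
    -- q`.
    obtain rfl | rfl : d = -1 ∨ d = 0 := by omega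
    all_goals omega
  · have ha : B.lb (B.m - h) ∈ B.E ∧ B.lc (B.l + h - 1) ∈ B.E := by
      rcases hxh with rfl | rfl
      · exact ⟨hx, by rwa [B.phi_bc h h1 h2] at hy⟩
      · exact ⟨by rwa [← B.phi_bc h h1 h2, phi_phi] at hy, hx⟩
    obtain ⟨c, hc⟩ := B.mem_E_lb (z := B.m - h) (by push_cast; rfl) ha.1
    obtain ⟨d, hd⟩ := B.mem_E_lc (z := B.l + h - 1) (by push_cast; rfl) ha.2
    simp only [v] at h2
    obtain ⟨c1, c2⟩ := eq_of_mul_bounds (a := B.q) (c := c) (k := 0) (l := 0) (by omega)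
      (by omega) (by omega)
    obtain ⟨d1, d2⟩ := eq_of_mul_bounds (a := B.s) (c := d) (k := 1) (l := 1) (by omega)
      (by omega) (by omega)
    obtain rfl : c = 0 := by omega
    -- Now `h = m`, so `m ≤ v` and `hml` applies.
    obtain rfl : d = 1 := by omega
    omega

/-! ### Labels and strand ends. -/

theorem isOver_attach_iff (x : B.Label) : B.diagram.IsOver (B.attach x) ↔ x ∈ B.E := by
  rw [mem_E_iff_val]
  unfold attach LinkDiagram.IsOver
  simp only
  split_ifs <;> simp_all; omega

theorem isUnder_attach_iff (x : B.Label) : B.diagram.IsUnder (B.attach x) ↔ x ∉ B.E := by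
  rw [mem_E_iff_val]
  unfold attach LinkDiagram.IsUnder
  simp only
  split_ifs <;> simp_all; omega

/-- The labels `x` and `-x` are the two ends of the same underarc, so off `E` the reflection is the
passage straight through the crossing. -/
theorem attach_gamma {x : B.Label} (hx : x ∉ B.E) :
    B.attach (B.gamma x) = ((B.attach x).1, (B.attach x).2 + 2) := by
  rw [mem_E_iff_val] at hx
  obtain ⟨β, x⟩ := x
  rw [gamma_mk]
  simp only [not_or] at hx
  obtain ⟨h0, h1⟩ := hx
  have hv := ZMod.val_lt x
  have hneg : (-x).val = 2 * B.len β - x.val := by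
    rw [ZMod.neg_val, if_neg (by rwa [ZMod.val_eq_zero] at h0)]
  unfold attach
  simp only [hneg, h0, h1, dite_false]
  rw [dif_neg (by omega)]
  by_cases h : x.val < B.len β
  · rw [dif_neg (by omega), dif_neg (by omega), dif_pos h]
    have e : 2 * B.len β - (2 * B.len β - x.val) = x.val := by omega
    simp only [e]
    rfl
  · rw [dif_pos (by omega), dif_neg h]
    rfl

theorem diagram_join_attach (x : B.Label) :
    B.diagram.join (B.attach x) = B.attach (B.phi x) := B.joinFun_attach x

theorem exists_attach_of_isUnder {d : B.Crossing × Fin 4} (hd : B.diagram.IsUnder d) :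
    ∃ x, d = B.attach x := by
  rcases B.dart_cases d with h | ⟨β, i, h, h', rfl | rfl⟩
  · exact h
  · simp [LinkDiagram.IsUnder] at hd
  · simp [LinkDiagram.IsUnder] at hd

theorem diagram_join_bridge {β : BridgeName} {i : ℕ} (hi : i ∈ Set.Ioo 0 (B.len β))
    (hi' : i + 1 ∈ Set.Ioo 0 (B.len β)) :
    B.diagram.join ((⟨β, i, hi⟩, 1) : B.Crossing × Fin 4) =
      ((⟨β, i + 1, hi'⟩, 3) : B.Crossing × Fin 4) := by
  have : B.joinFun (⟨β, i, hi⟩, 1) = (⟨β, i + 1, hi'⟩, 3) := by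
    simp only [joinFun]
    rw [dif_pos hi'.2]
  exact this

/-! ### Running along the bridges. -/

theorem sameComponent_bridge {β : BridgeName} (i : ℕ) (hi : i ∈ Set.Ioo 0 (B.len β)) :
    B.diagram.SameComponent ((⟨β, i, hi⟩, 1) : B.Crossing × Fin 4)
      (B.attach ⟨β, (B.len β : ℕ)⟩) := by
  have h2 := B.two_le_len β
  -- `k` counts the crossings still ahead on the segment.
  obtain ⟨k, hk⟩ : ∃ k, i + 1 + k = B.len β := ⟨B.len β - (i + 1), by have := hi.2; omega⟩
  induction k generalizing i with
  | zero =>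
    have e : B.attach ⟨β, (B.len β : ℕ)⟩ = ((⟨β, i, hi⟩, 1) : B.Crossing × Fin 4) := by
      have : ((B.len β : ℕ) : ZMod (2 * B.len β)).val = B.len β :=
        ZMod.val_natCast_of_lt (by omega)
      simp only [attach, this]
      rw [dif_neg (by omega), dif_neg (by omega), dif_pos trivial]
      obtain rfl : i = B.len β - 1 := by omega
      rfl
    rw [e]
    exact .refl _
  | succ k ih =>
    have hi' : i + 1 ∈ Set.Ioo 0 (B.len β) := ⟨by omega, by omega⟩
    refine .trans _ ((⟨β, i + 1, hi'⟩, 3) : B.Crossing × Fin 4) _ (.rel _ _ (Or.inl ?_))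
      (.trans _ _ _ (.rel _ _ (Or.inr ?_)) (ih (i + 1) hi' (by omega)))
    · exact (B.diagram_join_bridge hi hi').symm
    · rfl

/-- Following the overpass to the end of its segment and then along the arc outside leads to an
underpass. -/
theorem not_forall_isOver (d : B.Crossing × Fin 4) :
    ¬ ∀ d', B.diagram.SameComponent d d' → B.diagram.IsOver d' := by
  intro H
  obtain ⟨⟨β, i, hi⟩, k⟩ := d
  set e : B.Label := ⟨β, (B.len β : ℕ)⟩ with he
  have hd : B.diagram.SameComponent ((⟨β, i, hi⟩, k) : B.Crossing × Fin 4) (B.attach e) := by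
    have hk := H _ (.refl _)
    rcases (hk : k = 1 ∨ k = 3) with rfl | rfl
    · exact B.sameComponent_bridge i hi
    · exact .trans _ _ _ (.rel _ _ (Or.inr rfl)) (B.sameComponent_bridge i hi)
  have h1 := H _ hd
  have h2 := H _ (.trans _ _ _ hd (.rel _ _ (Or.inl (B.diagram_join_attach e).symm)))
  rw [isOver_attach_iff] at h1 h2
  exact B.phi_notMem_E h1 h2

/-- An edge leaving a segment starts at an endpoint and cannot arrive at another, so an edge between
overpasses stays on one segment. -/
theorem fst_eq_of_isOver {d d' : B.Crossing × Fin 4} (hd : B.diagram.IsOver d)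
    (hd' : B.diagram.IsOver d') (h : B.joinFun d = d') : d.1.1 = d'.1.1 := by
  subst h
  rcases B.dart_cases d with ⟨z, rfl⟩ | ⟨β, k, hk, hk', rfl | rfl⟩
  · rw [joinFun_attach, isOver_attach_iff] at hd'
    rw [isOver_attach_iff] at hd
    exact absurd hd' (B.phi_notMem_E hd)
  · simp only [joinFun]
    rw [dif_pos hk']
  · simp only [joinFun]
    rw [dif_pos (by omega)]

/-- Two crossings are on the same bridge of the diagram iff they are on the same segment. -/
theorem bridgeSetoid_iff (x y : B.Crossing) : B.diagram.bridgeSetoid x y ↔ x.1 = y.1 := by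
  constructor
  · intro h
    change Relation.EqvGen _ x y at h
    induction h with
    | rel x y h =>
      obtain ⟨i, j, hi, hj, h⟩ := h
      exact B.fst_eq_of_isOver (d := (x, i)) (d' := (y, j)) hi hj h
    | refl => rfl
    | symm _ _ _ ih => exact ih.symm
    | trans _ _ _ _ _ ih1 ih2 => exact ih1.trans ih2
  · have key : ∀ (β : BridgeName) (h1 : 1 ∈ Set.Ioo 0 (B.len β)) (i : ℕ)
        (hi : i + 1 ∈ Set.Ioo 0 (B.len β)),
        B.diagram.bridgeSetoid (⟨β, 1, h1⟩ : B.Crossing) (⟨β, i + 1, hi⟩ : B.Crossing) := by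
      intro β h1 i
      induction i with
      | zero => intro hi; exact .refl _
      | succ i ih =>
        intro hi
        have hi2 := hi.2
        have hi3 : i + 1 ∈ Set.Ioo 0 (B.len β) := ⟨by omega, by omega⟩
        refine .trans _ _ _ (ih hi3) (.rel _ _ ⟨1, 3, Or.inl rfl, Or.inr rfl, ?_⟩)
        exact B.diagram_join_bridge hi3 hi
    obtain ⟨β, i, hi⟩ := x
    obtain ⟨β', j, hj⟩ := y
    rintro (rfl : β = β')
    have h1 : 1 ∈ Set.Ioo 0 (B.len β) := ⟨one_pos, B.two_le_len β⟩
    obtain ⟨i, rfl⟩ : ∃ k, i = k + 1 := ⟨i - 1, by have := hi.1; omega⟩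
    obtain ⟨j, rfl⟩ : ∃ k, j = k + 1 := ⟨j - 1, by have := hj.1; omega⟩
    exact .trans _ _ _ (.symm _ _ (key β h1 i hi)) (key β h1 j hj)

theorem numBridges_diagram : B.diagram.numBridges = 3 := by
  have e : Function.Bijective (Quotient.lift (s := B.diagram.bridgeSetoid)
      (fun x : B.Crossing => x.1) fun x y h => (B.bridgeSetoid_iff x y).1 h) := by
    constructor
    · rintro ⟨x⟩ ⟨y⟩ h
      exact Quotient.sound ((B.bridgeSetoid_iff x y).2 h)
    · intro β
      exact ⟨Quotient.mk B.diagram.bridgeSetoid (⟨β, 1, one_pos, B.two_le_len β⟩ : B.Crossing), rfl⟩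
  rw [LinkDiagram.numBridges, Nat.card_congr (Equiv.ofBijective _ e), card_bridgeName]

/-! ### The dihedral action on the cycles of `mu`. -/

theorem mu_apply (x : B.Label) : B.mu x = B.phi (B.gamma x) := rfl

theorem mu_ne (x : B.Label) : B.mu x ≠ x :=
  fun h => B.phi_fst_ne (B.gamma x) (show (B.mu x).1 = x.1 from congrArg (fun y => y.1) h)

theorem phi_eq_mu_gamma (x : B.Label) : B.phi x = B.mu (B.gamma x) := by
  rw [mu_apply, gamma_gamma]

/-- A product of two involutions is inverted under conjugation by either of them. -/
theorem gamma_mu_zpow (k : ℤ) (x : B.Label) :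
    B.gamma ((B.mu ^ k) x) = (B.mu ^ (-k)) (B.gamma x) := by
  have hg : B.gamma * B.gamma = 1 := Equiv.ext B.gamma_gamma
  have hp : B.phi * B.phi = 1 := Equiv.ext B.phi_phi
  have hc : SemiconjBy B.gamma B.mu B.mu⁻¹ := by
    rw [SemiconjBy, mu, mul_inv_rev, inv_eq_of_mul_eq_one_left hg, inv_eq_of_mul_eq_one_left hp,
      mul_assoc]
  have := (hc.zpow_right k).eq
  rw [inv_zpow'] at this
  exact congrArg (fun f : Equiv.Perm B.Label => f x) this

theorem sameCycle_gamma {e x : B.Label} (he : e ∈ B.E) (h : B.mu.SameCycle e x) :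
    B.mu.SameCycle e (B.gamma x) := by
  obtain ⟨k, rfl⟩ := h
  rw [gamma_mu_zpow, (B.gamma_eq_self_iff e).2 he]
  exact ⟨-k, rfl⟩

theorem sameCycle_phi {e x : B.Label} (he : e ∈ B.E) (h : B.mu.SameCycle e x) :
    B.mu.SameCycle e (B.phi x) := by
  rw [phi_eq_mu_gamma]
  exact (B.sameCycle_gamma he h).trans ⟨1, rfl⟩

/-- A cycle of `μ` through an endpoint of a bridge contains exactly two endpoints of bridges. -/
theorem ncard_sameCycle_inter_E {e : B.Label} (he : e ∈ B.E) :
    ({x | B.mu.SameCycle e x} ∩ B.E).ncard = 2 := by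
  have hge := (B.gamma_eq_self_iff e).2 he
  have hper : ∀ k : ℤ, (B.mu ^ k) e = e ↔ ((Function.minimalPeriod B.mu e : ℕ) : ℤ) ∣ k := by
    intro k
    exact (MulAction.zpow_smul_eq_iff_minimalPeriod_dvd (a := B.mu) (b := e))
  set N := Function.minimalPeriod B.mu e with hN
  have hpos : 0 < N := Function.minimalPeriod_pos_of_mem_periodicPts
    (B.mu.injective.mem_periodicPts e)
  have hdiff : ∀ a b : ℤ, (B.mu ^ a) e = (B.mu ^ b) e ↔ (N : ℤ) ∣ a - b := by
    intro a b
    have : B.mu ^ a = B.mu ^ b * B.mu ^ (a - b) := by rw [← zpow_add, add_sub_cancel]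
    rw [← hper, this, Equiv.Perm.mul_apply, (B.mu ^ b).injective.eq_iff]
  have hγ : ∀ k : ℤ, B.gamma ((B.mu ^ k) e) = (B.mu ^ (-k)) e := by
    intro k
    rw [gamma_mu_zpow, hge]
  -- On powers of `mu` applied to `e`, `phi` acts by k ↦ 1 - k. For N = 2h + 1 this would fix k = h
  -- + 1, but `phi` always changes the bridge.
  obtain ⟨h, hh⟩ : ∃ h, N = 2 * h := by
    rcases Nat.even_or_odd' N with ⟨h, hh | hh⟩
    · exact ⟨h, hh⟩
    · refine absurd (congrArg Sigma.fst ?_) (B.phi_fst_ne ((B.mu ^ (h + 1 : ℤ)) e))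
      rw [phi_eq_mu_gamma, hγ, ← Equiv.Perm.mul_apply, ← zpow_one_add, hdiff, hh]
      exact ⟨-1, by push_cast; ring⟩
  -- `gamma` acts by k ↦ -k modulo 2h, so its fixed points are the multiples of h: the classes of 0
  -- and h.
  have hset : {x | B.mu.SameCycle e x} ∩ B.E = {e, (B.mu ^ (h : ℤ)) e} := by
    ext x
    simp only [Set.mem_inter_iff, Set.mem_ofPred_eq, Set.mem_insert_iff, Set.mem_singleton_iff]
    constructor
    · rintro ⟨⟨k, rfl⟩, hx⟩
      rw [← gamma_eq_self_iff, hγ, hdiff, hh] at hx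
      obtain ⟨c, hc⟩ := hx
      push_cast at hc
      rw [hper, hdiff, hh]
      rcases Int.even_or_odd' c with ⟨d, rfl | rfl⟩
      · exact Or.inl ⟨-d, by push_cast; linarith⟩
      · exact Or.inr ⟨-d - 1, by push_cast; linarith⟩
    · rintro (rfl | rfl)
      · exact ⟨.refl _ _, he⟩
      · refine ⟨⟨h, rfl⟩, ?_⟩
        rw [← gamma_eq_self_iff, hγ, hdiff, hh]
        exact ⟨-1, by push_cast; ring⟩
  rw [hset, Set.ncard_pair]
  intro hc
  have := (hper h).1 hc.symm
  rw [hh] at this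
  have := Int.le_of_dvd (by omega) this
  omega

/-- The diagram has no trivial component iff every cycle of `μ` passes through `E`. -/
theorem not_hasTrivialComponent_iff :
    ¬ B.diagram.HasTrivialComponent ↔ ∀ x, ∃ e ∈ B.E, B.mu.SameCycle e x := by
  constructor
  · intro H
    by_contra! hx
    obtain ⟨x, hx⟩ := hx
    -- The strand ends at labels whose `mu`-cycle misses `E`. They are closed under both moves
    -- generating a component, and all are under.
    let P : B.Crossing × Fin 4 → Prop := fun d =>
      ∃ y, d = B.attach y ∧ ∀ e ∈ B.E, ¬ B.mu.SameCycle e y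
    have hE : ∀ y, (∀ e ∈ B.E, ¬ B.mu.SameCycle e y) → y ∉ B.E :=
      fun y hy h => hy y h (.refl _ _)
    have hjoin : ∀ d, P d → P (B.joinFun d) := by
      rintro _ ⟨y, rfl, hy⟩
      refine ⟨B.phi y, B.joinFun_attach y, fun e he h => hy e he ?_⟩
      simpa only [phi_phi] using B.sameCycle_phi he h
    have hopp : ∀ d, P d → P (d.1, d.2 + 2) := by
      rintro _ ⟨y, rfl, hy⟩
      refine ⟨B.gamma y, (B.attach_gamma (hE y hy)).symm, fun e he h => hy e he ?_⟩
      simpa only [gamma_gamma] using B.sameCycle_gamma he h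
    have hP : ∀ d d', B.diagram.SameComponent d d' → (P d ↔ P d') := by
      intro d d' h
      induction h with
      | rel d d' h =>
        rcases h with rfl | rfl
        · refine ⟨hjoin d, fun h => ?_⟩
          have := hjoin _ h
          rwa [show B.joinFun (B.diagram.join d) = d from B.diagram.join_join d] at this
        · refine ⟨hopp d, fun h => ?_⟩
          -- Both moves are involutions, so closure under them gives the converse implication too.
          have h4 : d.2 + 2 + 2 = d.2 := by rw [add_assoc]; exact add_zero d.2
          have := hopp _ h
          simp only [h4] at this
          exact this
      | refl => rfl
      | symm _ _ _ ih => exact ih.symm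
      | trans _ _ _ _ _ ih1 ih2 => exact ih1.trans ih2
    refine H ⟨B.attach x, Or.inl fun d' hd' => ?_⟩
    obtain ⟨y, rfl, hy⟩ := (hP _ _ hd').1 ⟨x, rfl, hx⟩
    exact (B.isUnder_attach_iff y).2 (hE y hy)
  · rintro H ⟨d, hd | hd⟩
    · obtain ⟨x, rfl⟩ := B.exists_attach_of_isUnder (hd d (.refl _))
      -- As long as the component stays under, each label reached is off `E`, so a step of `mu` is a
      -- straight passage followed by an arc. Some power of `mu` reaches `E`, a contradiction.
      have hmu : ∀ k : ℕ, B.diagram.SameComponent (B.attach x) (B.attach ((B.mu ^ k) x)) := by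
        intro k
        induction k with
        | zero => exact .refl _
        | succ k ih =>
          have hk := (B.isUnder_attach_iff _).1 (hd _ ih)
          rw [pow_succ', Equiv.Perm.mul_apply, mu_apply, ← joinFun_attach]
          exact .trans _ _ _ ih (.trans _ _ _ (.rel _ _ (Or.inr (B.attach_gamma hk)))
            (.rel _ _ (Or.inl rfl)))
      obtain ⟨e, he, hex⟩ := H x
      obtain ⟨k, -, hk⟩ := hex.symm.exists_pow_eq'
      have := hd _ (hmu k)
      rw [hk, isUnder_attach_iff] at this
      exact this he
    · exact B.not_forall_isOver d hd

end ThreeButterfly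

theorem mainTheorem4 (B : ThreeButterfly) :
    B.IsSchubertForm ↔
      ∃ τ : Fin 3 → Equiv.Perm B.Label,
        (∀ i, (τ i).IsCycle) ∧
        (∀ i j, i ≠ j → (τ i).Disjoint (τ j)) ∧
        B.mu = τ 0 * τ 1 * τ 2 ∧
        ∀ i, ({x | τ i x ≠ x} ∩ B.E).ncard = 2 := by
  rw [← Equiv.Perm.forall_sameCycle_iff_three_cycles B.mu B.E B.ncard_E B.mu_ne
    fun e he => B.ncard_sameCycle_inter_E he, ← B.not_hasTrivialComponent_iff]
  -- The bridge count holds for every butterfly, so being reduced only concerns trivial components.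
  exact and_iff_right B.numBridges_diagram
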